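/- Fix $\lambda\ge 0$, $y\in\mathbb R^2$ and $s\ge 0$. For $0<R_1\le R_2\le D$ consider the following finite network. The legitimate nodes form a homogeneous Poisson point process $\Phi$ of intensity $\lambda$ on the disk $\mathcal B(o,D)\subset\mathbb R^2$ of radius $D$ centred at the origin. Every node $x\in\Phi$ with $\|x\|\le R_1$ is a jammer, and every node $x\in\Phi$ with $R_1<\|x\|\le R_2$ is a (long-range) jammer, independently of everything else, with probability $P(\|x\|)\in[0,1]$; no other node is a jammer. Let $\Phi_J$ be the set of jammers. The fading coefficients $h_{x,y}$, $x\in\Phi$, are i.i.d. exponential random variables with mean $1$, independent of $\Phi$, and the sum interference at $y$ with path loss exponent $\alpha=4$ is $$I(y)=\sum_{x\in\Phi_J}h_{x,y}\,\|x-y\|^{-4}.$$ Suppose that there are no long-range jammers, that is, $P\equiv 0$. Then $I(y)$ is almost surely finite and, as $R_1\to\infty$ (with $R_2$ and $D$ arbitrary subject to $R_1\le R_2\le D$), $$\mathbb E\left[e^{-sI(y)}\right]\longrightarrow\exp\left(-\frac{\lambda\sqrt s\,\pi^2}{2}\right).$$ The limit is the Laplace transform at $s$ of the interference in the infinite network: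 if $\Phi$ is a homogeneous Poisson point process of intensity $\lambda$ on the whole plane $\mathbb R^2$ and the $h_{x,y}$ are i.i.d. exponential with mean $1$ and independent of $\Phi$, then $I(y)=\sum_{x\in\Phi}h_{x,y}\,\|x-y\|^{-4}$ is almost surely finite and $\mathbb E[e^{-sI(y)}]=\exp(-\lambda\sqrt s\,\pi^2/2)$. -/

import Mathlib

open MeasureTheory ProbabilityTheory Filter Topology
open scoped NNReal ENNReal

/-- The Euclidean plane. -/
abbrev Plane : Type := EuclideanSpace ℝ (Fin 2)

/-- A point process is given by an enumeration of its points: `N ω` is the (possibly infinite)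
number of points and `X i ω`, for `i < N ω`, are their locations. `nodes N ω` is the set of the
indices that are in use. -/
def nodes {Ω : Type*} (N : Ω → ℕ∞) (ω : Ω) : Set ℕ :=
  {i | (i : ℕ∞) < N ω}

/-- The number of points of the process that lie in `B`. -/
noncomputable def pointCount {Ω : Type*} (N : Ω → ℕ∞) (X : ℕ → Ω → Plane) (B : Set Plane)
    (ω : Ω) : ℕ∞ :=
  {i | i ∈ nodes N ω ∧ X i ω ∈ B}.encard

/-- The point process `(N, X)` is a Poisson point process with intensity measure `Λ`: the number
of points in a measurable set `B` of finite intensity is Poisson distributed with mean `Λ B`, and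
the numbers of points in finitely many pairwise disjoint such sets are independent. -/
structure IsPoissonProcess {Ω : Type*} [MeasurableSpace Ω] (μ : Measure Ω) (N : Ω → ℕ∞)
    (X : ℕ → Ω → Plane) (Λ : Measure Plane) : Prop where
  measurable_number : Measurable N
  measurable_point : ∀ i, Measurable (X i)
  law_count : ∀ B : Set Plane, MeasurableSet B → Λ B ≠ ∞ → ∀ k : ℕ,
    μ {ω | pointCount N X B ω = k} = poissonMeasure (Λ B).toNNReal {k}
  indep_count : ∀ (n : ℕ) (B : Fin n → Set Plane), (∀ j, MeasurableSet (B j)) →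
    (∀ j, Λ (B j) ≠ ∞) → Pairwise (fun j k => Disjoint (B j) (B k)) →
    iIndepFun (fun j ω => pointCount N X (B j) ω) μ

/-- A Poisson point process of nodes with intensity measure `Λ`, together with Rayleigh fading:
`h i` is the fading coefficient of the channel from the `i`-th node to the location under
consideration. The coefficients are i.i.d. exponential with unit mean and independent of the
nodes. -/
structure IsRayleighPoisson {Ω : Type*} [MeasurableSpace Ω] (μ : Measure Ω) (N : Ω → ℕ∞)
    (X : ℕ → Ω → Plane) (h : ℕ → Ω → ℝ) (Λ : Measure Plane) : Prop where
  poisson : IsPoissonProcess μ N X Λ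
  measurable_fading : ∀ i, Measurable (h i)
  law_fading : ∀ i, μ.map (h i) = expMeasure 1
  indep_fading : iIndepFun h μ
  indep_fading_nodes : IndepFun (fun ω i => h i ω) (fun ω => (N ω, fun i => X i ω)) μ

/-- The finite network in the disk of radius `D` around the origin: the legitimate nodes form a
homogeneous Poisson point process of intensity `lam` on the disk, with Rayleigh fading, and each
node carries a mark `u i`, uniform on `[0, 1]`, that decides its selection. The marks are i.i.d.
and independent of the nodes and of the fading. -/
structure IsFiniteNetwork {Ω : Type*} [MeasurableSpace Ω] (μ : Measure Ω) (lam : ℝ≥0) (D : ℝ)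
    (N : Ω → ℕ∞) (X : ℕ → Ω → Plane) (h u : ℕ → Ω → ℝ) : Prop where
  rayleigh : IsRayleighPoisson μ N X h
    (lam • (volume : Measure Plane).restrict (Metric.closedBall 0 D))
  measurable_mark : ∀ i, Measurable (u i)
  law_mark : ∀ i, μ.map (u i) = (volume : Measure ℝ).restrict (Set.Icc 0 1)
  indep_mark : iIndepFun u μ
  indep_mark_nodes_fading :
    IndepFun (fun ω i => u i ω) (fun ω => ((N ω, fun i => X i ω), fun i => h i ω)) μ

/-- The local friendship circle of radius `R₁`. -/
def localCircle (R₁ : ℝ) : Set Plane := Metric.closedBall 0 R₁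

/-- The long-range friendship annulus with radii `R₁` and `R₂`. -/
def longRangeAnnulus (R₁ R₂ : ℝ) : Set Plane := {x | R₁ < ‖x‖ ∧ ‖x‖ ≤ R₂}

/-- The (indices of the) jammers: all nodes in the local friendship circle, and those nodes `x` in
the long-range friendship annulus that are selected, which happens independently with probability
`P ‖x‖`. -/
def jammers {Ω : Type*} (R₁ R₂ : ℝ) (P : ℝ → ℝ) (N : Ω → ℕ∞) (X : ℕ → Ω → Plane)
    (u : ℕ → Ω → ℝ) (ω : Ω) : Set ℕ :=
  {i | i ∈ nodes N ω ∧ (X i ω ∈ localCircle R₁ ∨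
    (X i ω ∈ longRangeAnnulus R₁ R₂ ∧ u i ω < P ‖X i ω‖))}

/-- The sum interference `∑ h_x ‖x - y‖ ^ (-α)` at `y` over the nodes with index in `J ω`, as a
value in `[0, ∞]`. -/
noncomputable def interference {Ω : Type*} (α : ℝ) (X : ℕ → Ω → Plane) (h : ℕ → Ω → ℝ)
    (J : Ω → Set ℕ) (y : Plane) (ω : Ω) : ℝ≥0∞ :=
  ∑' i : J ω, ENNReal.ofReal (h i ω) / ENNReal.ofReal (‖X i ω - y‖ ^ α)

/-- The Laplace transform `𝔼[exp (-s Z)]` of an almost surely finite random variable `Z ≥ 0`. -/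
noncomputable def laplaceTransform {Ω : Type*} [MeasurableSpace Ω] (μ : Measure Ω)
    (Z : Ω → ℝ≥0∞) (s : ℝ) : ℝ :=
  ∫ ω, Real.exp (-(s * (Z ω).toReal)) ∂μ

/-! With `P ≡ 0` the jammers are almost surely the nodes in the ball of radius `R₁`. Given the
nodes, each `x` contributes the factor `1 / (1 + s ‖x - y‖ ^ (-4))`, the mean of `exp (-s h ‖x - y‖
^ (-4))` over the fading `h`. The probability generating functional
(`IsPoissonProcess.lintegral_expNeg_pointSum`) turns the product of these factors into `exp (-λ ∫ s
/ (s + ‖x - y‖ ^ 4) dx)` over that ball (`IsRayleighPoisson.lintegral_expNeg_shotNoise`). As `R₁ →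
∞` the integral increases to the one over the plane, which polar coordinates evaluate to `√s π² / 2`
(`lintegral_div_add_norm_pow_four`).

Laplace transforms are computed in `[0, ∞]` with `exp (-∞) = 0`, so finiteness of the interference
is not needed beforehand. It follows instead: the transform is at least `exp (-λ √s π² / 2)`, which
tends to `1` as `s → 0` (`IsRayleighPoisson.setInterference_lt_top`). -/

/-! ### The exponential on `[0, ∞]`. -/

/-- The function `t ↦ exp (-t)` on `[0, ∞]`, with value `0` at `∞`. -/
noncomputable def expNeg (t : ℝ≥0∞) : ℝ≥0∞ := EReal.exp (-(t : EReal))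

@[simp] lemma expNeg_zero : expNeg 0 = 1 := by simp [expNeg]

@[simp] lemma expNeg_top : expNeg ∞ = 0 := by simp [expNeg]

lemma expNeg_add (a b : ℝ≥0∞) : expNeg (a + b) = expNeg a * expNeg b := by
  unfold expNeg
  rw [EReal.coe_ennreal_add, EReal.neg_add (by simp) (by simp), sub_eq_add_neg, EReal.exp_add]

lemma expNeg_antitone : Antitone expNeg := fun a b hab => by
  unfold expNeg
  rw [EReal.exp_le_exp_iff, EReal.neg_le_neg_iff]
  exact_mod_cast hab

lemma expNeg_le_one (t : ℝ≥0∞) : expNeg t ≤ 1 := by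
  simpa using expNeg_antitone (zero_le (a := t))

lemma expNeg_ne_top (t : ℝ≥0∞) : expNeg t ≠ ∞ :=
  ((expNeg_le_one t).trans_lt ENNReal.one_lt_top).ne

lemma continuous_expNeg : Continuous expNeg :=
  ENNReal.continuous_exp.comp (continuous_neg.comp continuous_coe_ennreal_ereal)

lemma measurable_expNeg : Measurable expNeg := continuous_expNeg.measurable

lemma expNeg_ofReal {t : ℝ} (ht : 0 ≤ t) :
    expNeg (ENNReal.ofReal t) = ENNReal.ofReal (Real.exp (-t)) := by
  unfold expNeg
  rw [EReal.coe_ennreal_ofReal, max_eq_left ht, ← EReal.coe_neg, EReal.exp_coe]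

lemma expNeg_of_ne_top {t : ℝ≥0∞} (ht : t ≠ ∞) :
    expNeg t = ENNReal.ofReal (Real.exp (-t.toReal)) := by
  rw [← expNeg_ofReal ENNReal.toReal_nonneg, ENNReal.ofReal_toReal ht]

lemma expNeg_sum {ι : Type*} (s : Finset ι) (f : ι → ℝ≥0∞) :
    expNeg (∑ i ∈ s, f i) = ∏ i ∈ s, expNeg (f i) := by
  classical
  induction s using Finset.induction_on with
  | empty => simp
  | insert a s ha ih => rw [Finset.sum_insert ha, Finset.prod_insert ha, expNeg_add, ih]

lemma expNeg_mul_natCast (a : ℝ≥0∞) (k : ℕ) : expNeg (a * k) = expNeg a ^ k := by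
  have := expNeg_sum (Finset.range k) (fun _ => a)
  simpa [mul_comm] using this

/-- Puts the fading factor `1 / (1 + c)` in the form to which the generating functional applies.
Since `log (1 + c) ≥ 0`, `toENNReal` loses nothing. -/
lemma expNeg_toENNReal_log_one_add (c : ℝ≥0∞) :
    expNeg (ENNReal.log (1 + c)).toENNReal = (1 + c)⁻¹ := by
  unfold expNeg
  rw [EReal.coe_toENNReal (by simp), ← ENNReal.log_inv, ENNReal.exp_log]

/-! ### Sums over the points of a process. -/

section PointSum

variable {Ω : Type*} {N : Ω → ℕ∞} {X : ℕ → Ω → Plane}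

/-- The sum of `f` over the points of the process. -/
noncomputable def pointSum (N : Ω → ℕ∞) (X : ℕ → Ω → Plane) (f : Plane → ℝ≥0∞) (ω : Ω) : ℝ≥0∞ :=
  ∑' i, (nodes N ω).indicator (fun i => f (X i ω)) i

lemma pointSum_indicator_const (B : Set Plane) (a : ℝ≥0∞) (ω : Ω) :
    pointSum N X (B.indicator fun _ => a) ω = a * (pointCount N X B ω : ℝ≥0∞) := by
  unfold pointSum pointCount
  rw [mul_comm, ← ENNReal.tsum_set_const, tsum_subtype _ (fun _ => a)]
  congr 1
  ext i
  simp only [Set.indicator, Set.mem_ofPred_eq]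
  split_ifs <;> simp_all

lemma pointSum_sum {ι : Type*} (s : Finset ι) (f : ι → Plane → ℝ≥0∞) (ω : Ω) :
    pointSum N X (fun x => ∑ j ∈ s, f j x) ω = ∑ j ∈ s, pointSum N X (f j) ω := by
  unfold pointSum
  rw [← Summable.tsum_finsetSum (fun _ _ => ENNReal.summable)]
  congr 1
  ext i
  by_cases h : i ∈ nodes N ω <;> simp [h]

end PointSum

/-! ### The probability generating functional of a Poisson process. -/

section Pgfl

variable {Ω : Type*} [MeasurableSpace Ω] {μ : Measure Ω} {N : Ω → ℕ∞} {X : ℕ → Ω → Plane}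
  {Λ : Measure Plane}

lemma measurableSet_mem_nodes (hN : Measurable N) (i : ℕ) : MeasurableSet {ω | i ∈ nodes N ω} :=
  hN (MeasurableSet.of_discrete (s := {n : ℕ∞ | (i : ℕ∞) < n}))

lemma measurable_pointSum (hN : Measurable N) (hX : ∀ i, Measurable (X i)) {f : Plane → ℝ≥0∞}
    (hf : Measurable f) : Measurable (pointSum N X f) := by
  refine Measurable.tsum fun i => ?_
  have : (fun ω => (nodes N ω).indicator (fun i => f (X i ω)) i)
      = {ω | i ∈ nodes N ω}.indicator (fun ω => f (X i ω)) := by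
    ext ω; simp [Set.indicator]
  rw [this]
  exact (hf.comp (hX i)).indicator (measurableSet_mem_nodes hN i)

lemma measurable_pointCount (hN : Measurable N) (hX : ∀ i, Measurable (X i)) {B : Set Plane}
    (hB : MeasurableSet B) : Measurable (pointCount N X B) := by
  have h1 : Measurable fun ω => (pointCount N X B ω : ℝ≥0∞) := by
    have := measurable_pointSum hN hX (measurable_const.indicator (f := fun _ => (1 : ℝ≥0∞)) hB)
    simpa [funext (pointSum_indicator_const (N := N) (X := X) B 1)] using this
  refine measurable_to_countable' fun k => ?_
  have : pointCount N X B ⁻¹' {k} = (fun ω => (pointCount N X B ω : ℝ≥0∞)) ⁻¹' {(k : ℝ≥0∞)} := by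
    ext ω; simp
  rw [this]
  exact h1 (measurableSet_singleton _)

lemma tsum_pow_mul_poissonMeasure (m : ℝ≥0) {q : ℝ} (hq : 0 ≤ q) (hq1 : q ≤ 1) :
    ∑' k : ℕ, ENNReal.ofReal q ^ k * poissonMeasure m {k} = expNeg (m * ENNReal.ofReal (1 - q)) := by
  have h1 : ∀ k : ℕ, ENNReal.ofReal q ^ k * poissonMeasure m {k}
      = ENNReal.ofReal (Real.exp (-m) * ((m * q) ^ k / k.factorial)) := fun k => by
    rw [poissonMeasure_singleton, ← ENNReal.ofReal_pow hq, ← ENNReal.ofReal_mul (by positivity)]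
    congr 1
    rw [mul_pow]; ring
  have h2 : HasSum (fun k : ℕ => Real.exp (-m) * ((m * q) ^ k / k.factorial))
      (Real.exp (-(m * (1 - q)))) := by
    have := (NormedSpace.expSeries_div_hasSum_exp ((m : ℝ) * q)).mul_left (Real.exp (-m))
    rwa [← Real.exp_eq_exp_ℝ, ← Real.exp_add, show -(m : ℝ) + m * q = -(m * (1 - q)) by ring] at this
  simp_rw [h1]
  rw [← ENNReal.ofReal_tsum_of_nonneg (fun k => by positivity) h2.summable, h2.tsum_eq,
    ← expNeg_ofReal (mul_nonneg m.coe_nonneg (sub_nonneg.2 hq1)), ENNReal.ofReal_mul m.coe_nonneg]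
  simp

lemma IsPoissonProcess.lintegral_expNeg_mul_pointCount [IsProbabilityMeasure μ]
    (hP : IsPoissonProcess μ N X Λ) {B : Set Plane} (hB : MeasurableSet B) (hΛ : Λ B ≠ ∞)
    (a : ℝ≥0∞) :
    ∫⁻ ω, expNeg (a * (pointCount N X B ω : ℝ≥0∞)) ∂μ = expNeg (Λ B * (1 - expNeg a)) := by
  have hm := measurable_pointCount hP.measurable_number hP.measurable_point hB
  set ν := μ.map (pointCount N X B) with hν
  have : IsProbabilityMeasure ν := Measure.isProbabilityMeasure_map hm.aemeasurable
  have hk : ∀ k : ℕ, ν {(k : ℕ∞)} = poissonMeasure (Λ B).toNNReal {k} := fun k => by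
    rw [hν, Measure.map_apply hm (measurableSet_singleton _), ← hP.law_count B hB hΛ k]
    rfl
  have hinj : Function.Injective ((↑) : ℕ → ℕ∞) := Nat.cast_injective
  have hsum : ∀ F : ℕ∞ → ℝ≥0∞, ∑' n, F n = (∑' k : ℕ, F k) + F ⊤ := fun F => by
    have h := Summable.tsum_add_tsum_compl (f := F) (s := Set.range ((↑) : ℕ → ℕ∞))
      ENNReal.summable ENNReal.summable
    have hc : (Set.range ((↑) : ℕ → ℕ∞))ᶜ = {⊤} := by
      ext n; induction n <;> simp
    rw [← h, tsum_range F hinj, hc, tsum_singleton]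
  -- `law_count` prescribes only the masses at finite `k`; they already sum to `1`, so none is left
  -- for `⊤`.
  have htop : ν {⊤} = 0 := by
    have h1 : ∑' n, ν {n} = 1 := by
      rw [← measure_univ (μ := ν), ← Set.biUnion_of_singleton (Set.univ : Set ℕ∞),
        measure_biUnion (Set.to_countable _) (fun a _ b _ h => by simpa using h) (by simp)]
      exact (tsum_univ fun n => ν {n}).symm
    have h2 : ∑' k : ℕ, poissonMeasure (Λ B).toNNReal {k} = 1 := by
      rw [← measure_univ (μ := poissonMeasure (Λ B).toNNReal),
        ← Set.biUnion_of_singleton (Set.univ : Set ℕ),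
        measure_biUnion (Set.to_countable _) (fun a _ b _ h => by simpa using h) (by simp)]
      exact (tsum_univ fun n => poissonMeasure (Λ B).toNNReal {n}).symm
    rw [hsum] at h1
    simp_rw [hk] at h1
    rw [h2] at h1
    exact (ENNReal.add_right_inj ENNReal.one_ne_top).1 (by rw [h1, add_zero])
  have e : ∫⁻ ω, expNeg (a * (pointCount N X B ω : ℝ≥0∞)) ∂μ
      = ∫⁻ n : ℕ∞, expNeg (a * (n : ℝ≥0∞)) ∂ν :=
    (lintegral_map (f := fun n : ℕ∞ => expNeg (a * (n : ℝ≥0∞))) Measurable.of_discrete hm).symm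
  rw [e, lintegral_countable', hsum, htop, mul_zero, add_zero]
  simp_rw [hk, ENat.toENNReal_coe, expNeg_mul_natCast]
  have hq : expNeg a = ENNReal.ofReal (expNeg a).toReal :=
    (ENNReal.ofReal_toReal (expNeg_ne_top a)).symm
  have hq1 : (expNeg a).toReal ≤ 1 := ENNReal.toReal_mono ENNReal.one_ne_top (expNeg_le_one a)
  rw [hq, tsum_pow_mul_poissonMeasure _ ENNReal.toReal_nonneg hq1, ENNReal.coe_toNNReal hΛ,
    ENNReal.ofReal_sub _ ENNReal.toReal_nonneg, ENNReal.ofReal_one]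

/-- Both sides factor over `j`: the left by independence of the counts in disjoint sets, the right
because at most one indicator is nonzero at each point. -/
lemma IsPoissonProcess.lintegral_expNeg_pointSum_step [IsProbabilityMeasure μ]
    (hP : IsPoissonProcess μ N X Λ) (n : ℕ) (B : Fin n → Set Plane) (a : Fin n → ℝ≥0∞)
    (hB : ∀ j, MeasurableSet (B j)) (hΛ : ∀ j, Λ (B j) ≠ ∞)
    (hd : Pairwise fun j k => Disjoint (B j) (B k)) :
    ∫⁻ ω, expNeg (pointSum N X (fun x => ∑ j, (B j).indicator (fun _ => a j) x) ω) ∂μ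
      = expNeg (∫⁻ x, (1 - expNeg (∑ j, (B j).indicator (fun _ => a j) x)) ∂Λ) := by
  have h1 : ∀ x, 1 - expNeg (∑ j, (B j).indicator (fun _ => a j) x)
      = ∑ j, (B j).indicator (fun _ => 1 - expNeg (a j)) x := fun x => by
    by_cases hx : ∃ j, x ∈ B j
    · obtain ⟨j, hj⟩ := hx
      have hk : ∀ k, k ≠ j → x ∉ B k := fun k hk hxk => Set.disjoint_left.1 (hd hk) hxk hj
      rw [Finset.sum_eq_single j (fun k _ h => by simp [hk k h]) (by simp),
        Finset.sum_eq_single j (fun k _ h => by simp [hk k h]) (by simp)]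
      simp [hj]
    · push Not at hx
      simp [hx]
  simp_rw [h1]
  rw [lintegral_finsetSum _ fun j _ => measurable_const.indicator (hB j), expNeg_sum]
  simp_rw [pointSum_sum, pointSum_indicator_const, expNeg_sum]
  rw [lintegral_prod_eq_prod_lintegral_of_indepFun Finset.univ
    (fun j ω => expNeg (a j * (pointCount N X (B j) ω : ℝ≥0∞)))]
  · refine Finset.prod_congr rfl fun j _ => ?_
    rw [hP.lintegral_expNeg_mul_pointCount (hB j) (hΛ j), lintegral_indicator_const (hB j), mul_comm]
  · exact (hP.indep_count n B hB hΛ hd).comp (fun j (m : ℕ∞) => expNeg (a j * (m : ℝ≥0∞)))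
      fun j => Measurable.of_discrete
  · exact fun j => (Measurable.of_discrete (f := fun m : ℕ∞ => expNeg (a j * (m : ℝ≥0∞)))).comp
      (measurable_pointCount hP.measurable_number hP.measurable_point (hB j))

/-- The fibres of `f` may have infinite intensity, where the Poisson axioms say nothing; hence the
cut-off to `S`. -/
lemma IsPoissonProcess.lintegral_expNeg_pointSum_simpleFunc [IsProbabilityMeasure μ]
    (hP : IsPoissonProcess μ N X Λ) (f : SimpleFunc Plane ℝ≥0∞) {S : Set Plane}
    (hS : MeasurableSet S) (hΛ : Λ S ≠ ∞) :
    ∫⁻ ω, expNeg (pointSum N X (S.indicator f) ω) ∂μ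
      = expNeg (∫⁻ x, (1 - expNeg (S.indicator f x)) ∂Λ) := by
  let e := f.range.equivFin
  let a : Fin f.range.card → ℝ≥0∞ := fun j => (e.symm j : ℝ≥0∞)
  have hf : S.indicator f = fun x => ∑ j, (S ∩ f ⁻¹' {a j}).indicator (fun _ => a j) x := by
    ext x
    by_cases hx : x ∈ S
    · rw [Finset.sum_eq_single (e ⟨f x, f.mem_range_self x⟩)]
      · simp [hx, a]
      · intro j _ hj
        refine Set.indicator_of_notMem (fun h => hj ?_) _
        exact (e.symm_apply_eq.1 (Subtype.ext h.2.symm))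
      · simp
    · simp [hx]
  rw [hf]
  refine hP.lintegral_expNeg_pointSum_step _ (fun j => S ∩ f ⁻¹' {a j}) a
    (fun j => hS.inter (f.measurableSet_fiber _))
    (fun j => ((measure_mono Set.inter_subset_left).trans_lt hΛ.lt_top).ne) fun j k hjk => ?_
  refine Set.disjoint_left.2 fun x h1 h2 => hjk ?_
  exact e.symm.injective (Subtype.ext (h1.2.symm.trans h2.2))

/-- The probability generating functional of a Poisson point process. -/
theorem IsPoissonProcess.lintegral_expNeg_pointSum [IsProbabilityMeasure μ] [SigmaFinite Λ]
    (hP : IsPoissonProcess μ N X Λ) {f : Plane → ℝ≥0∞} (hf : Measurable f) :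
    ∫⁻ ω, expNeg (pointSum N X f ω) ∂μ = expNeg (∫⁻ x, (1 - expNeg (f x)) ∂Λ) := by
  -- Simple functions increasing to `f`, cut off to sets of finite intensity exhausting the plane.
  let F : ℕ → Plane → ℝ≥0∞ := fun n => (spanningSets Λ n).indicator (SimpleFunc.eapprox f n)
  have hFm : ∀ n, Measurable (F n) := fun n =>
    (SimpleFunc.eapprox f n).measurable.indicator (measurableSet_spanningSets Λ n)
  have hmono : Monotone F := fun m n hmn x => by
    refine (Set.indicator_le_indicator_of_subset (monotone_spanningSets Λ hmn)
      (fun _ => zero_le) x).trans ?_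
    exact Set.indicator_le_indicator (SimpleFunc.monotone_eapprox f hmn x)
  have hlim : ∀ x, Tendsto (fun n => F n x) atTop (𝓝 (f x)) := fun x => by
    refine (SimpleFunc.tendsto_eapprox hf x).congr' ?_
    filter_upwards [eventually_ge_atTop (spanningSetsIndex Λ x)] with n hn
    exact (Set.indicator_of_mem (mem_spanningSets_of_index_le Λ x hn) _).symm
  have hsum : ∀ ω, Tendsto (fun n => pointSum N X (F n) ω) atTop (𝓝 (pointSum N X f ω)) := by
    intro ω
    unfold pointSum
    -- As integrals against counting measure on the indices, the sums converge by monotone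
    -- convergence.
    simp_rw [← lintegral_count]
    refine lintegral_tendsto_of_tendsto_of_monotone (fun n => Measurable.of_discrete.aemeasurable)
      (.of_forall fun i m n hmn => ?_) (.of_forall fun i => ?_)
    · exact Set.indicator_le_indicator (hmono hmn _)
    · by_cases hi : i ∈ nodes N ω
      · simpa [hi] using hlim _
      · simp [hi]
  have hL : Tendsto (fun n => ∫⁻ ω, expNeg (pointSum N X (F n) ω) ∂μ) atTop
      (𝓝 (∫⁻ ω, expNeg (pointSum N X f ω) ∂μ)) := by
    refine tendsto_lintegral_of_dominated_convergence (fun _ => 1) (fun n => ?_)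
      (fun n => .of_forall fun ω => expNeg_le_one _) (by simp)
      (.of_forall fun ω => (continuous_expNeg.tendsto _).comp (hsum ω))
    exact measurable_expNeg.comp
      (measurable_pointSum hP.measurable_number hP.measurable_point (hFm n))
  have hR : Tendsto (fun n => expNeg (∫⁻ x, (1 - expNeg (F n x)) ∂Λ)) atTop
      (𝓝 (expNeg (∫⁻ x, (1 - expNeg (f x)) ∂Λ))) := by
    refine (continuous_expNeg.tendsto _).comp ?_
    refine lintegral_tendsto_of_tendsto_of_monotone
      (fun n => (measurable_const.sub (measurable_expNeg.comp (hFm n))).aemeasurable)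
      (.of_forall fun x m n hmn => ?_) (.of_forall fun x => ?_)
    · exact tsub_le_tsub_left (expNeg_antitone (hmono hmn x)) _
    · exact ENNReal.Tendsto.sub tendsto_const_nhds ((continuous_expNeg.tendsto _).comp (hlim x))
        (.inl ENNReal.one_ne_top)
  refine tendsto_nhds_unique hL (hR.congr fun n => ?_)
  exact (hP.lintegral_expNeg_pointSum_simpleFunc _ (measurableSet_spanningSets Λ n)
    (measure_spanningSets_lt_top Λ n).ne).symm

end Pgfl

/-! ### Rayleigh fading and shot noise. -/

/-- For finite `c`, `exp (-t c)` times the rate-`1` density is `(1 + c)⁻¹` times the density of rate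
`1 + c`. The value `c = ∞` occurs when a node sits at `y`. -/
lemma lintegral_expNeg_expMeasure (c : ℝ≥0∞) :
    ∫⁻ t, expNeg (ENNReal.ofReal t * c) ∂(expMeasure 1) = (1 + c)⁻¹ := by
  have hm : Measurable fun t : ℝ => expNeg (ENNReal.ofReal t * c) :=
    measurable_expNeg.comp (ENNReal.measurable_ofReal.mul_const c)
  have hd : expMeasure 1 = volume.withDensity (exponentialPDF 1) := rfl
  have hpm : ∀ r, Measurable (exponentialPDF r) := fun r =>
    (measurable_exponentialPDFReal r).ennreal_ofReal
  rw [hd, lintegral_withDensity_eq_lintegral_mul _ (hpm 1) hm]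
  by_cases hc : c = ∞
  · subst hc
    simp only [add_top, ENNReal.inv_top]
    rw [lintegral_eq_zero_iff ((hpm 1).mul hm)]
    filter_upwards [measure_eq_zero_iff_ae_notMem.1 (measure_singleton (μ := volume) (0 : ℝ))]
      with t ht
    rcases lt_or_gt_of_ne (show t ≠ 0 by simpa using ht) with h | h
    · simp [exponentialPDF_of_neg h]
    · simp [ENNReal.mul_top, h]
  · have hr : 0 < 1 + c.toReal := by positivity
    have hc1 : 1 + c = ENNReal.ofReal (1 + c.toReal) := by
      rw [ENNReal.ofReal_add zero_le_one ENNReal.toReal_nonneg, ENNReal.ofReal_toReal hc,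
        ENNReal.ofReal_one]
    have : ∀ t, (exponentialPDF 1 * fun t : ℝ => expNeg (ENNReal.ofReal t * c)) t
        = (1 + c)⁻¹ * exponentialPDF (1 + c.toReal) t := fun t => by
      rw [Pi.mul_apply]
      rcases lt_or_ge t 0 with h | h
      · simp [exponentialPDF_of_neg h]
      · rw [exponentialPDF_of_nonneg h, exponentialPDF_of_nonneg h, hc1]
        conv_lhs => rw [← ENNReal.ofReal_toReal hc]
        rw [← ENNReal.ofReal_mul h, expNeg_ofReal (by positivity),
          ← ENNReal.ofReal_mul (by positivity), ← ENNReal.ofReal_inv_of_pos hr,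
          ← ENNReal.ofReal_mul (by positivity), inv_mul_cancel_left₀ hr.ne', one_mul, one_mul,
          ← Real.exp_add]
        congr 2
        ring
    simp_rw [this]
    rw [lintegral_const_mul _ (hpm _), lintegral_exponentialPDF_eq_one hr, mul_one]

section Fading

variable {Ω : Type*} [MeasurableSpace Ω] {μ : Measure Ω} {N : Ω → ℕ∞} {X : ℕ → Ω → Plane}
  {h : ℕ → Ω → ℝ} {Λ : Measure Plane}

/-- Independence handles finite sums; dominated convergence with bound `1` passes to the series. -/
lemma lintegral_expNeg_tsum_fading [IsProbabilityMeasure μ] (hh : ∀ i, Measurable (h i))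
    (hlaw : ∀ i, μ.map (h i) = expMeasure 1) (hind : iIndepFun h μ) (c : ℕ → ℝ≥0∞) :
    ∫⁻ ω, expNeg (∑' i, ENNReal.ofReal (h i ω) * c i) ∂μ
      = expNeg (∑' i, (ENNReal.log (1 + c i)).toENNReal) := by
  have hg : ∀ i, Measurable fun t : ℝ => expNeg (ENNReal.ofReal t * c i) := fun i =>
    measurable_expNeg.comp (ENNReal.measurable_ofReal.mul_const _)
  have hfin : ∀ n : ℕ, ∫⁻ ω, expNeg (∑ i ∈ Finset.range n, ENNReal.ofReal (h i ω) * c i) ∂μ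
      = expNeg (∑ i ∈ Finset.range n, (ENNReal.log (1 + c i)).toENNReal) := fun n => by
    simp_rw [expNeg_sum]
    rw [lintegral_prod_eq_prod_lintegral_of_indepFun (Finset.range n)
      (fun i ω => expNeg (ENNReal.ofReal (h i ω) * c i))
      (hind.comp (fun i t => expNeg (ENNReal.ofReal t * c i)) hg) fun i => (hg i).comp (hh i)]
    refine Finset.prod_congr rfl fun i _ => ?_
    rw [expNeg_toENNReal_log_one_add, ← lintegral_expNeg_expMeasure, ← hlaw i,
      lintegral_map (hg i) (hh i)]
  refine tendsto_nhds_unique (f := fun n : ℕ => ∫⁻ ω, expNeg (∑ i ∈ Finset.range n,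
    ENNReal.ofReal (h i ω) * c i) ∂μ) (l := atTop) ?_ ?_
  · refine tendsto_lintegral_of_dominated_convergence (fun _ => 1) (fun n => ?_)
      (fun n => .of_forall fun ω => expNeg_le_one _) (by simp) (.of_forall fun ω =>
        (continuous_expNeg.tendsto _).comp (ENNReal.tendsto_nat_tsum _))
    exact measurable_expNeg.comp (Finset.measurable_fun_sum _ fun i _ =>
      (hh i).ennreal_ofReal.mul_const _)
  · simp_rw [hfin]
    exact (continuous_expNeg.tendsto _).comp (ENNReal.tendsto_nat_tsum _)

/-- The shot noise of the process with response function `g` and fading `h`. -/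
noncomputable def shotNoise (N : Ω → ℕ∞) (X : ℕ → Ω → Plane) (h : ℕ → Ω → ℝ)
    (g : Plane → ℝ≥0∞) (ω : Ω) : ℝ≥0∞ :=
  ∑' i, ENNReal.ofReal (h i ω) * (nodes N ω).indicator (fun i => g (X i ω)) i

lemma measurable_shotNoise (hN : Measurable N) (hX : ∀ i, Measurable (X i))
    (hh : ∀ i, Measurable (h i)) {g : Plane → ℝ≥0∞} (hg : Measurable g) :
    Measurable (shotNoise N X h g) := by
  refine Measurable.tsum fun i => (hh i).ennreal_ofReal.mul ?_
  have : (fun ω => (nodes N ω).indicator (fun i => g (X i ω)) i)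
      = {ω | i ∈ nodes N ω}.indicator (fun ω => g (X i ω)) := by
    ext ω; simp [Set.indicator]
  rw [this]
  exact (hg.comp (hX i)).indicator (measurableSet_mem_nodes hN i)

/-- The Laplace functional of the shot noise of a Poisson process with Rayleigh fading. -/
theorem IsRayleighPoisson.lintegral_expNeg_shotNoise [IsProbabilityMeasure μ] [SigmaFinite Λ]
    (hR : IsRayleighPoisson μ N X h Λ) {g : Plane → ℝ≥0∞} (hg : Measurable g) :
    ∫⁻ ω, expNeg (shotNoise N X h g ω) ∂μ = expNeg (∫⁻ x, (1 - (1 + g x)⁻¹) ∂Λ) := by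
  let f : Plane → ℝ≥0∞ := fun x => (ENNReal.log (1 + g x)).toENNReal
  have hf : Measurable f :=
    (ENNReal.measurable_log.comp (measurable_const.add hg)).ereal_toENNReal
  -- The shot noise as a function on the space of values of fading and nodes: their joint law is a
  -- product, so the fading is integrated out with the nodes held fixed.
  let Φ : (ℕ → ℝ) × (ℕ∞ × (ℕ → Plane)) → ℝ≥0∞ :=
    shotNoise (fun p => p.2.1) (fun i p => p.2.2 i) (fun i p => p.1 i) g
  have hΦ : Measurable Φ := measurable_shotNoise (by fun_prop) (by fun_prop) (by fun_prop) hg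
  have mh : Measurable fun ω i => h i ω := measurable_pi_lambda _ hR.measurable_fading
  have mn : Measurable fun ω => (N ω, fun i => X i ω) :=
    hR.poisson.measurable_number.prodMk (measurable_pi_lambda _ hR.poisson.measurable_point)
  have hprod := (indepFun_iff_map_prod_eq_prod_map_map mh.aemeasurable mn.aemeasurable).1
    hR.indep_fading_nodes
  have := Measure.isProbabilityMeasure_map (μ := μ) mh.aemeasurable
  have := Measure.isProbabilityMeasure_map (μ := μ) mn.aemeasurable
  have hE : Measurable fun p => expNeg (Φ p) := measurable_expNeg.comp hΦ
  calc ∫⁻ ω, expNeg (shotNoise N X h g ω) ∂μ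
      = ∫⁻ p, expNeg (Φ p) ∂(μ.map fun ω => (fun i => h i ω, (N ω, fun i => X i ω))) :=
        (lintegral_map hE (mh.prodMk mn)).symm
    _ = ∫⁻ q, ∫⁻ t, expNeg (Φ (t, q)) ∂(μ.map fun ω i => h i ω)
          ∂(μ.map fun ω => (N ω, fun i => X i ω)) := by
        rw [hprod, lintegral_prod_symm _ hE.aemeasurable]
    _ = ∫⁻ ω, ∫⁻ ω', expNeg (Φ (fun i => h i ω', (N ω, fun i => X i ω))) ∂μ ∂μ := by
        rw [lintegral_map hE.lintegral_prod_left' mn]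
        refine lintegral_congr fun ω => ?_
        exact lintegral_map (hE.comp measurable_prodMk_right) mh
    _ = ∫⁻ ω, expNeg (pointSum N X f ω) ∂μ := by
        refine lintegral_congr fun ω => ?_
        have := lintegral_expNeg_tsum_fading hR.measurable_fading hR.law_fading hR.indep_fading
          (fun i => (nodes N ω).indicator (fun i => g (X i ω)) i)
        refine Eq.trans ?_ (this.trans ?_)
        · rfl
        · congr 1
          refine tsum_congr fun i => ?_
          by_cases hi : i ∈ nodes N ω <;> simp [hi, f]
    _ = expNeg (∫⁻ x, (1 - (1 + g x)⁻¹) ∂Λ) := by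
        rw [hR.poisson.lintegral_expNeg_pointSum hf]
        simp_rw [f, expNeg_toENNReal_log_one_add]

end Fading

/-! ### The path loss integral over the plane. -/

/-- The path loss `s ‖x - y‖ ^ (-4)` scaled by the Laplace variable `s`. -/
noncomputable def pathLoss (s : ℝ) (y x : Plane) : ℝ≥0∞ :=
  ENNReal.ofReal s / ENNReal.ofReal (‖x - y‖ ^ (4 : ℝ))

lemma measurable_pathLoss (s : ℝ) (y : Plane) : Measurable (pathLoss s y) := by
  unfold pathLoss
  fun_prop

lemma one_sub_inv_one_add_pathLoss {s : ℝ} (hs : 0 < s) (y x : Plane) :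
    1 - (1 + pathLoss s y x)⁻¹ = ENNReal.ofReal (s / (s + ‖x - y‖ ^ 4)) := by
  unfold pathLoss
  rw [show ‖x - y‖ ^ (4 : ℝ) = ‖x - y‖ ^ 4 by exact_mod_cast Real.rpow_natCast _ 4]
  set r := ‖x - y‖ ^ 4 with hr
  rcases (show 0 ≤ r by positivity).eq_or_lt with h | h
  -- At `x = y` the path loss is `∞`, and both sides equal `1`.
  · rw [← h, ENNReal.ofReal_zero, ENNReal.div_zero (by simpa using hs)]
    simp [hs.ne']
  · rw [← ENNReal.ofReal_div_of_pos h, ← ENNReal.ofReal_one,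
      ← ENNReal.ofReal_add zero_le_one (by positivity), ← ENNReal.ofReal_inv_of_pos (by positivity),
      ← ENNReal.ofReal_sub _ (by positivity)]
    congr 1
    field_simp
    ring

/-- The antiderivative is `√s / 2 * arctan (r ^ 2 / √s)`, with limit `√s / 2 * (π / 2)` at infinity.
-/
lemma integral_Ioi_mul_div_add_pow_four {s : ℝ} (hs : 0 < s) :
    IntegrableOn (fun r : ℝ => r * (s / (s + r ^ 4))) (Set.Ioi 0) ∧
    ∫ r in Set.Ioi (0 : ℝ), r * (s / (s + r ^ 4)) = √s * Real.pi / 4 := by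
  have hq : 0 < √s := Real.sqrt_pos.2 hs
  have hd : ∀ r ∈ Set.Ici (0 : ℝ), HasDerivAt (fun r => √s / 2 * Real.arctan (r ^ 2 / √s))
      (r * (s / (s + r ^ 4))) r := fun r _ => by
    refine ((((hasDerivAt_pow 2 r).div_const (√s)).arctan).const_mul (√s / 2)).congr_deriv ?_
    have h2 : (r ^ 2 / √s) ^ 2 = r ^ 4 / s := by
      rw [div_pow, Real.sq_sqrt hs.le]; ring
    rw [h2]
    push_cast
    field_simp
  have hp : ∀ r ∈ Set.Ioi (0 : ℝ), 0 ≤ r * (s / (s + r ^ 4)) := fun r hr => by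
    have : (0 : ℝ) < r := hr
    positivity
  have ht : Tendsto (fun r => √s / 2 * Real.arctan (r ^ 2 / √s)) atTop
      (𝓝 (√s / 2 * (Real.pi / 2))) := by
    refine Tendsto.const_mul _ ?_
    exact (tendsto_nhds_of_tendsto_nhdsWithin Real.tendsto_arctan_atTop).comp
      ((tendsto_pow_atTop two_ne_zero).atTop_div_const hq)
  refine ⟨integrableOn_Ioi_deriv_of_nonneg' hd hp ht, ?_⟩
  rw [integral_Ioi_of_hasDerivAt_of_nonneg' hd hp ht]
  simp
  ring

lemma lintegral_div_add_norm_pow_four {s : ℝ} (hs : 0 < s) (y : Plane) :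
    ∫⁻ x : Plane, ENNReal.ofReal (s / (s + ‖x - y‖ ^ 4))
      = ENNReal.ofReal (√s * Real.pi ^ 2 / 2) := by
  rw [lintegral_sub_right_eq_self (fun x : Plane => ENNReal.ofReal (s / (s + ‖x‖ ^ 4))) y]
  obtain ⟨hi, hv⟩ := integral_Ioi_mul_div_add_pow_four hs
  have hI : Integrable (fun x : Plane => s / (s + ‖x‖ ^ 4)) := by
    refine (integrable_fun_norm_addHaar (E := Plane) volume
      (f := fun r : ℝ => s / (s + r ^ 4))).2 ?_
    simpa using hi
  -- Polar coordinates: dimension `2` times the unit disk area `π` times the radial integral `√s π /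
  -- 4`.
  rw [← ofReal_integral_eq_lintegral_ofReal hI (.of_forall fun x => by positivity),
    integral_fun_norm_addHaar (E := Plane) volume (fun r : ℝ => s / (s + r ^ 4))]
  simp only [finrank_euclideanSpace, Fintype.card_fin, Nat.add_one_sub_one, pow_one, smul_eq_mul,
    hv, measureReal_def, EuclideanSpace.volume_ball_fin_two]
  congr 1
  simp [Real.pi_pos.le]
  ring

lemma lintegral_one_sub_inv_one_add_pathLoss {s : ℝ} (hs : 0 ≤ s) (y : Plane) :
    ∫⁻ x, (1 - (1 + pathLoss s y x)⁻¹) = ENNReal.ofReal (√s * Real.pi ^ 2 / 2) := by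
  rcases hs.eq_or_lt with rfl | hs
  · simp [pathLoss]
  · simp_rw [one_sub_inv_one_add_pathLoss hs]
    exact lintegral_div_add_norm_pow_four hs y

/-! ### Interference from the nodes in a fixed set. -/

section SetInterference

variable {Ω : Type*} {N : Ω → ℕ∞} {X : ℕ → Ω → Plane} {h : ℕ → Ω → ℝ}

/-- The interference created by the nodes that lie in `A`. -/
noncomputable def setInterference (N : Ω → ℕ∞) (X : ℕ → Ω → Plane) (h : ℕ → Ω → ℝ)
    (A : Set Plane) (y : Plane) : Ω → ℝ≥0∞ :=
  interference 4 X h (fun ω => {i | i ∈ nodes N ω ∧ X i ω ∈ A}) y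

lemma ofReal_mul_setInterference (A : Set Plane) (y : Plane) {s : ℝ} (ω : Ω) :
    ENNReal.ofReal s * setInterference N X h A y ω
      = shotNoise N X h (A.indicator (pathLoss s y)) ω := by
  unfold setInterference interference shotNoise
  rw [tsum_subtype {i | i ∈ nodes N ω ∧ X i ω ∈ A}
    (fun i => ENNReal.ofReal (h i ω) / ENNReal.ofReal (‖X i ω - y‖ ^ (4 : ℝ))),
    ← ENNReal.tsum_mul_left]
  refine tsum_congr fun i => ?_
  by_cases h1 : i ∈ nodes N ω
  · by_cases h2 : X i ω ∈ A
    · simp only [Set.mem_ofPred_eq, h1, h2, and_self, Set.indicator_of_mem, pathLoss,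
        div_eq_mul_inv]
      ring
    · simp [h2]
  · simp [h1]

end SetInterference

section Interference

variable {Ω : Type*} [MeasurableSpace Ω] {μ : Measure Ω} {N : Ω → ℕ∞} {X : ℕ → Ω → Plane}
  {h : ℕ → Ω → ℝ} {Λ : Measure Plane}

lemma measurable_setInterference (hN : Measurable N) (hX : ∀ i, Measurable (X i))
    (hh : ∀ i, Measurable (h i)) {A : Set Plane} (hA : MeasurableSet A) (y : Plane) :
    Measurable (setInterference N X h A y) := by
  have := measurable_shotNoise hN hX hh ((measurable_pathLoss 1 y).indicator hA)
  simpa [← funext (ofReal_mul_setInterference (N := N) (X := X) (h := h) A y (s := 1))] using this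

lemma IsRayleighPoisson.lintegral_expNeg_setInterference [IsProbabilityMeasure μ] [SigmaFinite Λ]
    (hR : IsRayleighPoisson μ N X h Λ) {A : Set Plane} (hA : MeasurableSet A) (y : Plane) (s : ℝ) :
    ∫⁻ ω, expNeg (ENNReal.ofReal s * setInterference N X h A y ω) ∂μ
      = expNeg (∫⁻ x in A, (1 - (1 + pathLoss s y x)⁻¹) ∂Λ) := by
  simp_rw [ofReal_mul_setInterference]
  rw [hR.lintegral_expNeg_shotNoise ((measurable_pathLoss s y).indicator hA),
    ← lintegral_indicator hA]
  congr 2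
  ext x
  by_cases hx : x ∈ A <;> simp [hx]

lemma lintegral_one_sub_pathLoss_le (lam : ℝ≥0) (hΛ : Λ ≤ lam • (volume : Measure Plane))
    {s : ℝ} (hs : 0 ≤ s) (A : Set Plane) (y : Plane) :
    ∫⁻ x in A, (1 - (1 + pathLoss s y x)⁻¹) ∂Λ
      ≤ ENNReal.ofReal (lam * √s * Real.pi ^ 2 / 2) := by
  calc ∫⁻ x in A, (1 - (1 + pathLoss s y x)⁻¹) ∂Λ
      ≤ ∫⁻ x, (1 - (1 + pathLoss s y x)⁻¹) ∂(lam • (volume : Measure Plane)) :=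
        lintegral_mono' (Measure.restrict_le_self.trans hΛ) le_rfl
    _ = ENNReal.ofReal (lam * √s * Real.pi ^ 2 / 2) := by
        rw [lintegral_smul_measure, lintegral_one_sub_inv_one_add_pathLoss hs, ENNReal.smul_def,
          smul_eq_mul, ← ENNReal.ofReal_coe_nnreal, ← ENNReal.ofReal_mul lam.coe_nonneg]
        congr 1
        ring

/-- The interference is almost surely finite if the intensity is at most that of a homogeneous
process. -/
theorem IsRayleighPoisson.setInterference_lt_top [IsProbabilityMeasure μ] [SigmaFinite Λ]
    (hR : IsRayleighPoisson μ N X h Λ) (lam : ℝ≥0) (hΛ : Λ ≤ lam • (volume : Measure Plane))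
    {A : Set Plane} (hA : MeasurableSet A) (y : Plane) :
    ∀ᵐ ω ∂μ, setInterference N X h A y ω < ∞ := by
  have hm := measurable_setInterference hR.poisson.measurable_number hR.poisson.measurable_point
    hR.measurable_fading hA y
  have hF : MeasurableSet {ω | setInterference N X h A y ω < ∞} := hm measurableSet_Iio
  -- For `s > 0` the integrand vanishes where the interference is infinite, so the transform is at
  -- most the probability of finiteness.
  have hle : ∀ s : ℝ, 0 < s → expNeg (ENNReal.ofReal (lam * √s * Real.pi ^ 2 / 2))
      ≤ μ {ω | setInterference N X h A y ω < ∞} := fun s hs => by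
    calc expNeg (ENNReal.ofReal (lam * √s * Real.pi ^ 2 / 2))
        ≤ ∫⁻ ω, expNeg (ENNReal.ofReal s * setInterference N X h A y ω) ∂μ := by
          rw [hR.lintegral_expNeg_setInterference hA y s]
          exact expNeg_antitone (lintegral_one_sub_pathLoss_le lam hΛ hs.le A y)
      _ ≤ ∫⁻ ω, {ω | setInterference N X h A y ω < ∞}.indicator 1 ω ∂μ := by
          refine lintegral_mono fun ω => ?_
          by_cases hω : setInterference N X h A y ω < ∞
          · simpa [hω] using expNeg_le_one _
          · rw [not_lt, top_le_iff] at hω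
            simp [hω, ENNReal.mul_top, hs]
      _ = μ {ω | setInterference N X h A y ω < ∞} := lintegral_indicator_one hF
  have hlim : Tendsto (fun s : ℝ => expNeg (ENNReal.ofReal (lam * √s * Real.pi ^ 2 / 2)))
      (𝓝[>] 0) (𝓝 1) := by
    have hc : Continuous fun s : ℝ => expNeg (ENNReal.ofReal (lam * √s * Real.pi ^ 2 / 2)) :=
      continuous_expNeg.comp (ENNReal.continuous_ofReal.comp (by fun_prop))
    simpa using (hc.tendsto 0).mono_left nhdsWithin_le_nhds
  refine (mem_ae_iff_prob_eq_one hF).2 (le_antisymm prob_le_one ?_)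
  exact le_of_tendsto hlim (eventually_nhdsWithin_of_forall hle)

/-- Almost sure finiteness is essential: `toReal` sends `∞` to `0`, where the real exponential is
`1` but `expNeg ∞ = 0`. -/
lemma laplaceTransform_eq_toReal_lintegral [IsProbabilityMeasure μ] {Z : Ω → ℝ≥0∞}
    (hZ : Measurable Z) (hfin : ∀ᵐ ω ∂μ, Z ω < ∞) {s : ℝ} (hs : 0 ≤ s) :
    laplaceTransform μ Z s = (∫⁻ ω, expNeg (ENNReal.ofReal s * Z ω) ∂μ).toReal := by
  have hm : Measurable fun ω => Real.exp (-(s * (Z ω).toReal)) :=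
    Real.measurable_exp.comp (hZ.ennreal_toReal.const_mul s).neg
  unfold laplaceTransform
  rw [integral_eq_lintegral_of_nonneg_ae (.of_forall fun ω => (Real.exp_pos _).le)
    hm.aestronglyMeasurable]
  congr 1
  refine lintegral_congr_ae ?_
  filter_upwards [hfin] with ω hω
  rw [expNeg_of_ne_top (ENNReal.mul_ne_top ENNReal.ofReal_ne_top hω.ne), ENNReal.toReal_mul,
    ENNReal.toReal_ofReal hs]

lemma IsRayleighPoisson.laplaceTransform_setInterference [IsProbabilityMeasure μ] [SigmaFinite Λ]
    (hR : IsRayleighPoisson μ N X h Λ) (lam : ℝ≥0) (hΛ : Λ ≤ lam • (volume : Measure Plane))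
    {A : Set Plane} (hA : MeasurableSet A) (y : Plane) {s : ℝ} (hs : 0 ≤ s) :
    laplaceTransform μ (setInterference N X h A y) s
      = (expNeg (∫⁻ x in A, (1 - (1 + pathLoss s y x)⁻¹) ∂Λ)).toReal := by
  rw [laplaceTransform_eq_toReal_lintegral
    (measurable_setInterference hR.poisson.measurable_number hR.poisson.measurable_point
      hR.measurable_fading hA y) (hR.setInterference_lt_top lam hΛ hA y) hs,
    hR.lintegral_expNeg_setInterference hA y s]

lemma toReal_expNeg_lintegral_pathLoss (lam : ℝ≥0) {s : ℝ} (hs : 0 ≤ s) (y : Plane) :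
    (expNeg (∫⁻ x, (1 - (1 + pathLoss s y x)⁻¹) ∂(lam • (volume : Measure Plane)))).toReal
      = Real.exp (-(lam * √s * Real.pi ^ 2 / 2)) := by
  rw [lintegral_smul_measure, lintegral_one_sub_inv_one_add_pathLoss hs, ENNReal.smul_def,
    smul_eq_mul, ← ENNReal.ofReal_coe_nnreal, ← ENNReal.ofReal_mul lam.coe_nonneg,
    expNeg_ofReal (by positivity), ENNReal.toReal_ofReal (Real.exp_pos _).le]
  congr 2
  ring

/-- Continuity from below of the measure with density `f`. The limit is along real `R`, so it
composes with `R₁` along any filter. -/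
lemma tendsto_setLIntegral_closedBall (m : Measure Plane) {f : Plane → ℝ≥0∞} :
    Tendsto (fun R : ℝ => ∫⁻ x in Metric.closedBall 0 R, f x ∂m) atTop (𝓝 (∫⁻ x, f x ∂m)) := by
  have hmono : Monotone fun R : ℝ => Metric.closedBall (0 : Plane) R :=
    fun _ _ => Metric.closedBall_subset_closedBall
  have hU : ⋃ R : ℝ, Metric.closedBall (0 : Plane) R = Set.univ :=
    Set.eq_univ_of_forall fun x => Set.mem_iUnion.2 ⟨‖x‖, by simp⟩
  have := tendsto_measure_iUnion_atTop (μ := m.withDensity f) hmono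
  simpa [hU, withDensity_apply _ Metric.isClosed_closedBall.measurableSet, Function.comp_def]
    using this

/-- Uniform marks are almost surely nonnegative, so `u i ω < 0` selects no long-range jammer. -/
lemma IsFiniteNetwork.interference_jammers_ae_eq {lam : ℝ≥0} {D : ℝ} {u : ℕ → Ω → ℝ}
    (hF : IsFiniteNetwork μ lam D N X h u) (R₁ R₂ : ℝ) (y : Plane) :
    interference 4 X h (jammers R₁ R₂ (fun _ => 0) N X u) y
      =ᵐ[μ] setInterference N X h (Metric.closedBall 0 R₁) y := by
  have hu : ∀ᵐ ω ∂μ, ∀ i, 0 ≤ u i ω := by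
    refine ae_all_iff.2 fun i => ?_
    have h1 : ∀ᵐ t ∂(μ.map (u i)), 0 ≤ t := by
      rw [hF.law_mark i]
      exact (ae_restrict_mem measurableSet_Icc).mono fun t ht => ht.1
    exact ae_of_ae_map (hF.measurable_mark i).aemeasurable h1
  filter_upwards [hu] with ω hω
  have : jammers R₁ R₂ (fun _ => 0) N X u ω
      = {i | i ∈ nodes N ω ∧ X i ω ∈ Metric.closedBall 0 R₁} := by
    ext i
    simp [jammers, localCircle, not_lt.2 (hω i)]
  unfold setInterference interference
  rw [this]

end Interference

theorem mainTheorem6 (lam : ℝ≥0) (y : Plane) (s : ℝ) (hs : 0 ≤ s) :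
    -- finite networks without long-range jammers, local friendship radius tending to infinity
    (∀ {ι : Type*} (l : Filter ι) (R₁ R₂ D : ι → ℝ)
        {Ω : ι → Type*} [∀ i, MeasurableSpace (Ω i)] (μ : ∀ i, Measure (Ω i))
        [∀ i, IsProbabilityMeasure (μ i)]
        (N : ∀ i, Ω i → ℕ∞) (X : ∀ i, ℕ → Ω i → Plane) (h u : ∀ i, ℕ → Ω i → ℝ),
        (∀ i, 0 < R₁ i) → (∀ i, R₁ i ≤ R₂ i) → (∀ i, R₂ i ≤ D i) →
        (∀ i, IsFiniteNetwork (μ i) lam (D i) (N i) (X i) (h i) (u i)) →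
        Tendsto R₁ l atTop →
        (∀ i, ∀ᵐ ω ∂(μ i), interference 4 (X i) (h i)
          (jammers (R₁ i) (R₂ i) (fun _ => 0) (N i) (X i) (u i)) y ω < ∞) ∧
        Tendsto (fun i => laplaceTransform (μ i) (interference 4 (X i) (h i)
          (jammers (R₁ i) (R₂ i) (fun _ => 0) (N i) (X i) (u i)) y) s) l
          (𝓝 (Real.exp (-(lam * √s * Real.pi ^ 2 / 2))))) ∧
    -- the limit is the Laplace transform for the homogeneous Poisson process in the whole plane
    (∀ {Ω : Type*} [MeasurableSpace Ω] (μ : Measure Ω) [IsProbabilityMeasure μ]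
        (N : Ω → ℕ∞) (X : ℕ → Ω → Plane) (h : ℕ → Ω → ℝ),
        IsRayleighPoisson μ N X h (lam • (volume : Measure Plane)) →
        (∀ᵐ ω ∂μ, interference 4 X h (nodes N) y ω < ∞) ∧
        laplaceTransform μ (interference 4 X h (nodes N) y) s =
          Real.exp (-(lam * √s * Real.pi ^ 2 / 2))) := by
  constructor
  · intro ι l R₁ R₂ D Ω _ μ _ N X h u _ h12 h2D hF hR
    have hball : ∀ R : ℝ, MeasurableSet (Metric.closedBall (0 : Plane) R) := fun R =>
      Metric.isClosed_closedBall.measurableSet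
    have hΛ : ∀ i, lam • (volume : Measure Plane).restrict (Metric.closedBall 0 (D i))
        ≤ lam • (volume : Measure Plane) := fun i => by
      rw [← Measure.restrict_smul]
      exact Measure.restrict_le_self
    have hae := fun i => (hF i).interference_jammers_ae_eq (R₁ i) (R₂ i) y
    have hfin := fun i => (hF i).rayleigh.setInterference_lt_top lam (hΛ i) (hball (R₁ i)) y
    refine ⟨fun i => ?_, ?_⟩
    · filter_upwards [hae i, hfin i] with ω h1 h2
      rwa [h1]
    · have hval : ∀ i, laplaceTransform (μ i) (interference 4 (X i) (h i)
          (jammers (R₁ i) (R₂ i) (fun _ => 0) (N i) (X i) (u i)) y) s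
          = (expNeg (∫⁻ x in Metric.closedBall 0 (R₁ i), (1 - (1 + pathLoss s y x)⁻¹)
            ∂(lam • (volume : Measure Plane)))).toReal := fun i => by
        have h1 : laplaceTransform (μ i) (interference 4 (X i) (h i)
            (jammers (R₁ i) (R₂ i) (fun _ => 0) (N i) (X i) (u i)) y) s
            = laplaceTransform (μ i)
              (setInterference (N i) (X i) (h i) (Metric.closedBall 0 (R₁ i)) y) s :=
          integral_congr_ae ((hae i).mono fun ω hω => by simp only [hω])
        -- Since `R₁ ≤ R₂ ≤ D`, restricting to the disk of radius `D` changes nothing on the ball of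
        -- radius `R₁`; thus `R₂` and `D` drop out.
        rw [h1, (hF i).rayleigh.laplaceTransform_setInterference lam (hΛ i) (hball _) y hs,
          ← Measure.restrict_smul, Measure.restrict_restrict (hball _),
          Set.inter_eq_self_of_subset_left
            (Metric.closedBall_subset_closedBall ((h12 i).trans (h2D i)))]
      simp_rw [hval]
      rw [← toReal_expNeg_lintegral_pathLoss lam hs y]
      exact (ENNReal.tendsto_toReal (expNeg_ne_top _)).comp ((continuous_expNeg.tendsto _).comp
        ((tendsto_setLIntegral_closedBall _).comp hR))
  · intro Ω _ μ _ N X h hR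
    have hset : interference 4 X h (nodes N) y = setInterference N X h Set.univ y := by
      simp [setInterference]
    rw [hset, hR.laplaceTransform_setInterference lam le_rfl .univ y hs, Measure.restrict_univ]
    exact ⟨hR.setInterference_lt_top lam le_rfl .univ y, toReal_expNeg_lintegral_pathLoss lam hs y⟩
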